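/- Let $K$ be a field that is complete with respect to a non-trivial non-Archimedean (possibly non-discrete) valuation $v\colon K\to\mathbb R\cup\{+\infty\}$, and let $R=\{a\in K : v(a)\ge 0\}$ be its ring of integers. For an integer $n\ge 0$, let $$\mathcal R_n=R\langle x_1,\dots,x_n\rangle=\Bigl\{\sum_{I\in\mathbb N^n}a_Ix^I : a_I\in R \text{ for all } I,\ \text{and } v(a_I)\to+\infty \text{ as } |I|\to+\infty\Bigr\}$$ be the ring of integral convergent power series, a subring of the ring $K[[x_1,\dots,x_n]]$ of formal power series. Then $\mathcal R_n$ has Krull dimension $n+1$. -/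

import Mathlib

/-- `K` is complete with respect to the (additive, real-valued) valuation `v`: every `v`-Cauchy
sequence has a `v`-limit. Here `v (x - y)` being large means that `x` and `y` are close. -/
def IsCompleteFor {K : Type*} [Field K] (v : AddValuation K (WithTop ℝ)) : Prop :=
  ∀ s : ℕ → K,
    (∀ M : ℝ, ∃ N : ℕ, ∀ i j : ℕ, N ≤ i → N ≤ j → (M : WithTop ℝ) ≤ v (s i - s j)) →
    ∃ a : K, ∀ M : ℝ, ∃ N : ℕ, ∀ i : ℕ, N ≤ i → (M : WithTop ℝ) ≤ v (s i - a)

/-- `v(a_I) → +∞` as `|I| → +∞`, for the coefficients `a_I` of a formal power series `f`;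
`I.degree` is `|I| = I_1 + ... + I_n`. -/
def CoeffsTendToTop {K : Type*} [Field K] (v : AddValuation K (WithTop ℝ)) {n : ℕ}
    (f : MvPowerSeries (Fin n) K) : Prop :=
  ∀ M : ℝ, ∃ N : ℕ, ∀ I : Fin n →₀ ℕ, N ≤ I.degree → (M : WithTop ℝ) ≤ v (MvPowerSeries.coeff I f)

/-- The ring `R⟨x_1, ..., x_n⟩` of integral convergent power series, where
`R = {a : K | 0 ≤ v a}`: the formal power series `∑ a_I x^I` with all `a_I ∈ R` and
`v(a_I) → +∞` as `|I| → +∞`, as a subring of `K[[x_1, ..., x_n]]`. -/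
def integralConvergentSeries {K : Type*} [Field K] (v : AddValuation K (WithTop ℝ)) (n : ℕ) :
    Subring (MvPowerSeries (Fin n) K) where
  carrier := {f | (∀ I : Fin n →₀ ℕ, 0 ≤ v (MvPowerSeries.coeff I f)) ∧ CoeffsTendToTop v f}
  zero_mem' := by
    refine ⟨fun I => ?_, fun M => ⟨0, fun I _ => ?_⟩⟩ <;> simp
  one_mem' := by
    classical
    refine ⟨fun I => ?_, fun M => ⟨1, fun I hI => ?_⟩⟩
    · rw [MvPowerSeries.coeff_one]
      split_ifs <;> simp
    · rw [MvPowerSeries.coeff_one, if_neg]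
      · simp
      · rintro rfl
        simp at hI
  add_mem' := by
    rintro f g ⟨hf, hf'⟩ ⟨hg, hg'⟩
    refine ⟨fun I => ?_, fun M => ?_⟩
    · rw [map_add]
      exact v.map_le_add (hf I) (hg I)
    · obtain ⟨N₁, h₁⟩ := hf' M
      obtain ⟨N₂, h₂⟩ := hg' M
      refine ⟨max N₁ N₂, fun I hI => ?_⟩
      rw [map_add]
      exact v.map_le_add (h₁ I (le_trans (le_max_left _ _) hI))
        (h₂ I (le_trans (le_max_right _ _) hI))
  neg_mem' := by
    rintro f ⟨hf, hf'⟩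
    refine ⟨fun I => ?_, fun M => ?_⟩
    · rw [map_neg, v.map_neg]
      exact hf I
    · obtain ⟨N, h⟩ := hf' M
      refine ⟨N, fun I hI => ?_⟩
      rw [map_neg, v.map_neg]
      exact h I hI
  mul_mem' := by
    classical
    rintro f g ⟨hf, hf'⟩ ⟨hg, hg'⟩
    refine ⟨fun I => ?_, fun M => ?_⟩
    · rw [MvPowerSeries.coeff_mul]
      refine v.map_le_sum fun p _ => ?_
      rw [v.map_mul]
      exact add_nonneg (hf _) (hg _)
    · obtain ⟨N₁, h₁⟩ := hf' M
      obtain ⟨N₂, h₂⟩ := hg' M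
      refine ⟨N₁ + N₂, fun I hI => ?_⟩
      rw [MvPowerSeries.coeff_mul]
      refine v.map_le_sum fun p hp => ?_
      rw [v.map_mul]
      have hdeg : p.1.degree + p.2.degree = I.degree := by
        rw [← Finset.HasAntidiagonal.mem_antidiagonal.mp hp, map_add]
      rcases le_or_gt N₁ p.1.degree with h | h
      · exact le_trans (h₁ _ h) (le_add_of_nonneg_right (hg _))
      · exact le_trans (h₂ _ (by omega)) (le_add_of_nonneg_left (hf _))

/-! Write `m` for the maximal ideal of `R` and `k` for the residue field.

Lower bound: a nonzero constant of positive valuation is a non-unit, so `R_0` has dimension at least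
1. Setting one variable to zero maps the domain `R_(n+1)` onto `R_n` with nonzero kernel, so each
variable adds at least 1.

Upper bound, by strong induction on `n`: since `R_n` is a domain, it suffices that `R_n / P` has
dimension at most `n` for every nonzero prime `P`. A nonzero element of `P` factors as a nonzero
constant `c` times a primitive series `g`, one having a coefficient of valuation 0. If `c ∈ P`, then
`m ⊆ P` because the valuation has rank one, and `R_n / P` is a quotient of `k[x_1, ..., x_n]`. If `g
∈ P`, then `R_n / (g)` is finite over some `R_s` with `s < n`, so its dimension is at most `s + 1 ≤
n`.

This finiteness replaces Weierstrass preparation. Noether normalization of `k[x] / (g mod m)` gives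
integral equations modulo `m`, and their lifts have errors with coefficients in `m`. The ideal `m`
need not be finitely generated, but only finitely many polynomials occur, so a single nonzero `c ∈
m` divides all the errors. The equations then hold modulo `(g, c)`, and `c`-adic completeness lifts
finiteness from `R_n / (g, c)` to `R_n / (g)`. -/

/-! ### Krull dimension under integral maps and quotients -/

/-- Integral ring homomorphisms do not raise the Krull dimension. -/
theorem ringKrullDim_le_of_isIntegral {A B : Type*} [CommRing A] [CommRing B] (f : A →+* B)
    (hf : f.IsIntegral) : ringKrullDim B ≤ ringKrullDim A := by
  algebraize [f]
  refine Order.krullDim_le_of_strictMono (PrimeSpectrum.comap f) fun p q hpq => ?_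
  exact Ideal.IsIntegral.comap_lt_comap (R := A) (I := p.asIdeal) (J := q.asIdeal) hpq

/-- Going up: for an integral extension, the coheight of a prime ideal is at least the coheight of
its contraction. -/
theorem coheight_comap_le_of_isIntegral {A B : Type*} [CommRing A] [CommRing B] [Algebra A B]
    [Algebra.IsIntegral A B] (n : ℕ) (q : PrimeSpectrum B)
    (h : (n : ℕ∞) ≤ Order.coheight (PrimeSpectrum.comap (algebraMap A B) q)) :
    (n : ℕ∞) ≤ Order.coheight q := by
  induction n generalizing q with
  | zero => simp
  | succ n ih =>
    obtain ⟨l, hl, hlen⟩ := Order.exists_series_of_le_coheight _ h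
    have hpos : 0 < l.length := by omega
    -- The second term of a chain of length `n + 1`; a chain of length `n` still starts there.
    let p' : PrimeSpectrum A := l ⟨1, by omega⟩
    have hp' : PrimeSpectrum.comap (algebraMap A B) q < p' := by
      rw [← hl]
      exact l.strictMono (by simp [Fin.lt_def])
    have hn : (n : ℕ∞) ≤ Order.coheight p' := by
      have := Order.rev_index_le_coheight l ⟨1, by omega⟩
      refine le_trans ?_ this
      simp [Fin.rev, hlen]
    obtain ⟨Q, hQ, hQp, hQc⟩ := Ideal.exists_ideal_over_prime_of_isIntegral (R := A) p'.asIdeal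
      q.asIdeal hp'.le
    let q' : PrimeSpectrum B := ⟨Q, hQp⟩
    have hq' : PrimeSpectrum.comap (algebraMap A B) q' = p' := PrimeSpectrum.ext hQc
    have hlt : q < q' := by
      refine lt_of_le_of_ne hQ fun h => ?_
      rw [← h] at hq'
      exact hp'.ne hq'
    have := ih q' (hq' ▸ hn)
    push_cast
    exact le_trans (by gcongr) (Order.coheight_add_one_le hlt)

/-- The Krull dimension of a domain is at most that of an integral extension. -/
theorem ringKrullDim_le_of_isIntegral_of_injective {A B : Type*} [CommRing A] [CommRing B]
    [IsDomain A] (f : A →+* B) (hf : f.IsIntegral) (hinj : Function.Injective f) :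
    ringKrullDim A ≤ ringKrullDim B := by
  algebraize [f]
  have : FaithfulSMul A B := (faithfulSMul_iff_algebraMap_injective A B).mpr hinj
  obtain ⟨Q, -, hQp, hQc⟩ := Ideal.exists_ideal_over_prime_of_isIntegral (R := A) (S := B) ⊥ ⊥
    (Ideal.comap_bot_of_injective (algebraMap A B) hinj).le
  let q : PrimeSpectrum B := ⟨Q, hQp⟩
  have hq : PrimeSpectrum.comap (algebraMap A B) q = ⊥ := PrimeSpectrum.ext hQc
  rw [ringKrullDim, ← Order.coheight_bot_eq_krullDim]
  refine le_trans (WithBot.coe_le_coe.mpr ?_) (Order.coheight_le_krullDim q)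
  refine ENat.forall_natCast_le_iff_le.mp fun n hn => coheight_comap_le_of_isIntegral (A := A) n q ?_
  rwa [hq]

/-- A domain all of whose quotients by nonzero primes have dimension at most `n` has dimension at
most `n + 1`. -/
theorem ringKrullDim_le_of_forall_quotient {A : Type*} [CommRing A] [IsDomain A] (n : ℕ)
    (h : ∀ P : Ideal A, P.IsPrime → P ≠ ⊥ → ringKrullDim (A ⧸ P) ≤ n) :
    ringKrullDim A ≤ n + 1 := by
  rw [ringKrullDim, ← Order.coheight_bot_eq_krullDim]
  -- The coheight of a nonzero prime is the dimension of its quotient, and passing down to `⊥` adds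
  -- at most one step.
  have : Order.coheight (⊥ : PrimeSpectrum A) ≤ (n + 1 : ℕ) := by
    refine Order.coheight_le_coe_iff.mpr fun y hy => ?_
    have hy' : y.asIdeal ≠ ⊥ := fun h => hy.ne' (PrimeSpectrum.ext h)
    have := h y.asIdeal y.2 hy'
    rw [ringKrullDim_quotient] at this
    have hset : PrimeSpectrum.zeroLocus (y.asIdeal : Set A) = Set.Ici y := by
      ext; rfl
    rw [hset, ← Order.coheight_eq_krullDim_Ici] at this
    have h1 : Order.coheight y ≤ n := by exact_mod_cast this
    exact lt_of_le_of_lt h1 (by exact_mod_cast Nat.lt_succ_self n)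
  exact_mod_cast this

/-! ### Adic completeness and lifting of finiteness -/

/-- The partial sums are Cauchy, since all terms from index `N` on are divisible by `c ^ N`; `L` is
the value of the series. -/
theorem IsPrecomplete.exists_dvd_sub_sum {A : Type*} [CommRing A] {c : A}
    [IsPrecomplete (Ideal.span {c}) A] (a : ℕ → A) :
    ∃ L : A, ∀ N, c ^ N ∣ L - ∑ k ∈ Finset.range N, c ^ k * a k := by
  obtain ⟨L, hL⟩ := IsPrecomplete.prec (I := Ideal.span {c}) (M := A) inferInstance
    (f := fun N => ∑ k ∈ Finset.range N, c ^ k * a k) (fun {m n} hmn => by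
      rw [SModEq.comm, SModEq.sub_mem, smul_eq_mul, Ideal.mul_top, Ideal.span_singleton_pow,
        Ideal.mem_span_singleton, ← Finset.sum_Ico_eq_sub _ hmn]
      refine Finset.dvd_sum fun i hi => Dvd.dvd.mul_right (pow_dvd_pow _ ?_) _
      exact (Finset.mem_Ico.mp hi).1)
  refine ⟨L, fun N => ?_⟩
  have := (hL N).symm
  rwa [SModEq.sub_mem, smul_eq_mul, Ideal.mul_top, Ideal.span_singleton_pow,
        Ideal.mem_span_singleton] at this

theorem IsHausdorff.eq_zero_of_forall_dvd {A : Type*} [CommRing A] {c : A}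
    [IsHausdorff (Ideal.span {c}) A] (a : A) (h : ∀ N, c ^ N ∣ a) : a = 0 := by
  refine IsHausdorff.haus (I := Ideal.span {c}) (M := A) inferInstance a fun N => ?_
  rw [SModEq.zero, smul_eq_mul, Ideal.mul_top, Ideal.span_singleton_pow, Ideal.mem_span_singleton]
  exact h N

/-- A complete version of Nakayama's lemma: finiteness of `B ⧸ (f, c)` over `A` lifts to
finiteness of `B ⧸ (f)` if `A` and `B` are `c`-adically complete. -/
theorem Module.Finite.quotient_span_of_isAdicComplete {A B : Type*} [CommRing A] [CommRing B]
    [Algebra A B] (c : A) (f : B) [IsPrecomplete (Ideal.span {c}) A]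
    [IsAdicComplete (Ideal.span {algebraMap A B c}) B]
    [Module.Finite A (B ⧸ Ideal.span {f, algebraMap A B c})] :
    Module.Finite A (B ⧸ Ideal.span {f}) := by
  classical
  obtain ⟨d, b', hb'⟩ := Module.Finite.exists_fin (R := A)
    (M := B ⧸ Ideal.span {f, algebraMap A B c})
  choose b hb using fun i => Ideal.Quotient.mk_surjective (b' i)
  have key : ∀ h : B, ∃ (q : B) (a : Fin d → A) (h' : B),
      h = q * f + ∑ i, a i • b i + algebraMap A B c * h' := by
    intro h
    have : Ideal.Quotient.mk (Ideal.span {f, algebraMap A B c}) h ∈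
        Submodule.span A (Set.range b') := hb' ▸ Submodule.mem_top
    obtain ⟨a, ha⟩ := (Submodule.mem_span_range_iff_exists_fun A).mp this
    have : h - ∑ i, a i • b i ∈ Ideal.span {f, algebraMap A B c} := by
      rw [← Ideal.Quotient.eq, ← ha, map_sum]
      refine Finset.sum_congr rfl fun i _ => ?_
      rw [← hb i]
      rfl
    obtain ⟨q, r, hqr⟩ := Ideal.mem_span_pair.mp this
    exact ⟨q, a, r, by linear_combination -hqr⟩
  choose q a g hg using key
  refine ⟨⟨Finset.univ.image fun i => Ideal.Quotient.mk (Ideal.span {f}) (b i), ?_⟩⟩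
  rw [eq_top_iff]
  rintro x -
  obtain ⟨h, rfl⟩ := Ideal.Quotient.mk_surjective x
  -- Successive remainders: applying `key` repeatedly expands `h` as a `c`-adic series, whose
  -- coefficients are summed separately in `B` (for `f`) and in `A` (for each `b i`).
  let s : ℕ → B := fun k => g^[k] h
  obtain ⟨Q, hQ⟩ := IsPrecomplete.exists_dvd_sub_sum (c := algebraMap A B c) fun k => q (s k)
  choose L hL using fun i => IsPrecomplete.exists_dvd_sub_sum (c := c) fun k => a (s k) i
  have hsum : ∀ N, h = (∑ k ∈ Finset.range N, algebraMap A B c ^ k * q (s k)) * f +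
      ∑ i, (∑ k ∈ Finset.range N, c ^ k * a (s k) i) • b i + algebraMap A B c ^ N * s N := by
    intro N
    induction N with
    | zero => simp [s]
    | succ N ih =>
      have hs : s (N + 1) = g (s N) := Function.iterate_succ_apply' _ _ _
      have h1 : ∑ i, (∑ k ∈ Finset.range (N + 1), c ^ k * a (s k) i) • b i =
          ∑ i, (∑ k ∈ Finset.range N, c ^ k * a (s k) i) • b i +
            algebraMap A B c ^ N * ∑ i, a (s N) i • b i := by
        rw [Finset.mul_sum, ← Finset.sum_add_distrib]
        refine Finset.sum_congr rfl fun i _ => ?_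
        rw [Finset.sum_range_succ, add_smul, Algebra.smul_def (c ^ N * _), Algebra.smul_def (a _ _)]
        simp only [map_mul, map_pow, mul_assoc]
      rw [h1, Finset.sum_range_succ, hs]
      linear_combination ih + algebraMap A B c ^ N * hg (s N)
  have hzero : h - (Q * f + ∑ i, L i • b i) = 0 := by
    refine IsHausdorff.eq_zero_of_forall_dvd (c := algebraMap A B c) _ fun N => ?_
    have h2 : algebraMap A B c ^ N ∣
        ∑ i, (L i - ∑ k ∈ Finset.range N, c ^ k * a (s k) i) • b i := by
      refine Finset.dvd_sum fun i _ => ?_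
      rw [Algebra.smul_def, ← map_pow]
      exact Dvd.dvd.mul_right (map_dvd _ (hL i N)) _
    have h3 : h - (Q * f + ∑ i, L i • b i) = algebraMap A B c ^ N * s N -
        (Q - ∑ k ∈ Finset.range N, algebraMap A B c ^ k * q (s k)) * f -
        ∑ i, (L i - ∑ k ∈ Finset.range N, c ^ k * a (s k) i) • b i := by
      simp only [sub_smul, Finset.sum_sub_distrib]
      linear_combination hsum N
    rw [h3]
    exact dvd_sub (dvd_sub (dvd_mul_right _ _) (Dvd.dvd.mul_right (hQ N) _)) h2
  have hx : Ideal.Quotient.mk (Ideal.span {f}) h =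
      ∑ i, L i • Ideal.Quotient.mk (Ideal.span {f}) (b i) := by
    have : Ideal.Quotient.mk (Ideal.span {f}) h =
        Ideal.Quotient.mk (Ideal.span {f}) (∑ i, L i • b i) := by
      rw [Ideal.Quotient.eq, Ideal.mem_span_singleton]
      exact ⟨Q, by linear_combination hzero⟩
    rw [this, map_sum]
    rfl
  rw [hx]
  refine Submodule.sum_mem _ fun i _ => Submodule.smul_mem _ _ (Submodule.subset_span ?_)
  simp

/-! ### The valuation ring -/

/-- The ring of integers `{a | 0 ≤ v a}` of a valuation. -/
noncomputable abbrev AddValuation.integers {K : Type*} [Field K] (v : AddValuation K (WithTop ℝ)) :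
    ValuationSubring K :=
  v.toValuation.valuationSubring

namespace IntegralConvergentSeries

variable {K : Type*} [Field K] {v : AddValuation K (WithTop ℝ)} {n : ℕ}

theorem exists_real_eq {a : K} (ha : a ≠ 0) : ∃ r : ℝ, v a = r :=
  (WithTop.ne_top_iff_exists.mp (v.ne_top_iff.mpr ha)).imp fun _ h => h.symm

theorem div_mem_integers {a b : K} (ha : a ≠ 0) (h : v a ≤ v b) : 0 ≤ v (b / a) := by
  by_cases hb : b = 0
  · simp [hb]
  obtain ⟨r, hr⟩ := exists_real_eq (v := v) ha
  obtain ⟨s, hs⟩ := exists_real_eq (v := v) (div_ne_zero hb ha)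
  have h1 : v b = v (b / a) + v a := by rw [← v.map_mul, div_mul_cancel₀ _ ha]
  rw [h1, hr, hs] at h
  rw [hs]
  norm_cast at h ⊢
  linarith

theorem dvd_of_le {a b : v.integers} (ha : a ≠ 0) (h : v (a : K) ≤ v (b : K)) : a ∣ b := by
  have ha' : (a : K) ≠ 0 := by simpa using ha
  exact ⟨⟨(b : K) / a, div_mem_integers ha' h⟩, Subtype.ext (mul_div_cancel₀ _ ha').symm⟩

theorem isUnit_integers {a : v.integers} (h : v (a : K) = 0) : IsUnit a := by
  refine isUnit_of_dvd_one (dvd_of_le ?_ ?_)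
  · rintro rfl
    simp at h
  · simp [h]

theorem residue_eq_zero_iff {a : v.integers} :
    IsLocalRing.residue v.integers a = 0 ↔ 0 < v (a : K) := by
  rw [IsLocalRing.residue_eq_zero_iff, IsLocalRing.mem_maximalIdeal, mem_nonunits_iff]
  constructor
  · intro h
    exact lt_of_le_of_ne a.2 fun h' => h (isUnit_integers h'.symm)
  · rintro h ⟨u, rfl⟩
    have h1 : v ((u : v.integers) : K) + v ((u⁻¹ : v.integersˣ) : K) = 0 := by
      rw [← v.map_mul, ← Submonoid.coe_mul, Units.mul_inv, Submonoid.coe_one, v.map_one]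
    have h2 : 0 ≤ v ((u⁻¹ : v.integersˣ) : K) := (u⁻¹ : v.integersˣ).val.2
    exact absurd h1 (lt_of_lt_of_le h (le_add_of_nonneg_right h2)).ne'

/-- Real values are archimedean; this is where rank one enters. -/
theorem exists_le_pow {c : K} (hc : 0 < v c) (M : ℝ) : ∃ N : ℕ, (M : WithTop ℝ) ≤ v (c ^ N) := by
  by_cases h0 : c = 0
  · exact ⟨1, by simp [h0]⟩
  obtain ⟨r, hr⟩ := exists_real_eq (v := v) h0
  have hr0 : 0 < r := by rw [hr] at hc; exact_mod_cast hc
  obtain ⟨N, hN⟩ := Archimedean.arch M hr0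
  refine ⟨N, ?_⟩
  rw [v.map_pow, hr]
  exact_mod_cast hN

theorem eq_zero_of_forall_le {a : K} (h : ∀ M : ℝ, (M : WithTop ℝ) ≤ v a) : a = 0 := by
  by_contra h0
  obtain ⟨r, hr⟩ := exists_real_eq (v := v) h0
  have := h (r + 1)
  rw [hr] at this
  norm_cast at this
  linarith

theorem exists_pos (hv : ∃ a : K, a ≠ 0 ∧ v a ≠ 0) : ∃ c : v.integers, c ≠ 0 ∧ 0 < v (c : K) := by
  obtain ⟨a, ha, hva⟩ := hv
  rcases lt_or_gt_of_ne hva with h | h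
  · have h1 : 0 < v a⁻¹ := by
      obtain ⟨r, hr⟩ := exists_real_eq (v := v) ha
      obtain ⟨s, hs⟩ := exists_real_eq (v := v) (inv_ne_zero ha)
      have h2 : v a + v a⁻¹ = 0 := by rw [← v.map_mul, mul_inv_cancel₀ ha, v.map_one]
      rw [hr, hs] at h2
      rw [hr] at h
      rw [hs]
      norm_cast at h h2 ⊢
      linarith
    exact ⟨⟨a⁻¹, h1.le⟩, fun h => inv_ne_zero ha (congrArg Subtype.val h), h1⟩
  · exact ⟨⟨a, h.le⟩, fun h => ha (congrArg Subtype.val h), h⟩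

/-- Finitely many elements of the maximal ideal have a common nonzero divisor in the maximal
ideal. -/
theorem exists_common_divisor (hv : ∃ a : K, a ≠ 0 ∧ v a ≠ 0) (s : Finset v.integers)
    (hs : ∀ a ∈ s, 0 < v (a : K)) :
    ∃ c : v.integers, c ≠ 0 ∧ 0 < v (c : K) ∧ ∀ a ∈ s, c ∣ a := by
  classical
  induction s using Finset.induction_on with
  | empty =>
    obtain ⟨c, hc, hc'⟩ := exists_pos hv
    exact ⟨c, hc, hc', by simp⟩
  | insert a s _ ih =>
    obtain ⟨c, hc, hc', hcs⟩ := ih fun b hb => hs b (Finset.mem_insert_of_mem hb)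
    -- Divisibility is total in a valuation ring, so whichever of `a` and `c` has smaller valuation
    -- divides the other.
    by_cases h : v (c : K) ≤ v (a : K)
    · refine ⟨c, hc, hc', fun b hb => ?_⟩
      rcases Finset.mem_insert.mp hb with rfl | hb
      · exact dvd_of_le hc h
      · exact hcs b hb
    · have ha0 : a ≠ 0 := by
        rintro rfl
        simp at h
      have hac : a ∣ c := dvd_of_le ha0 (le_of_not_ge h)
      refine ⟨a, ha0, hs a (Finset.mem_insert_self _ _), fun b hb => ?_⟩
      rcases Finset.mem_insert.mp hb with rfl | hb
      · exact dvd_rfl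
      · exact hac.trans (hcs b hb)

/-! ### Polynomials and constants among the convergent series -/

/-- An element of the ring of integral convergent power series from its coefficients. -/
def mk (f : MvPowerSeries (Fin n) K) (h : ∀ I, 0 ≤ v (MvPowerSeries.coeff I f))
    (h' : CoeffsTendToTop v f) : integralConvergentSeries v n :=
  ⟨f, h, h'⟩

variable (v n) in
/-- Integral polynomials as integral convergent power series. -/
noncomputable def ofPoly :
    MvPolynomial (Fin n) v.integers →+* integralConvergentSeries v n :=
  (MvPolynomial.coeToMvPowerSeries.ringHom.comp
    (MvPolynomial.map v.integers.subtype)).codRestrict _ fun p => by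
      refine ⟨fun I => ?_, fun M => ?_⟩
      · simp only [RingHom.comp_apply, MvPolynomial.coeToMvPowerSeries.ringHom_apply,
          MvPolynomial.coeff_coe, MvPolynomial.coeff_map]
        exact (p.coeff I).2
      · refine ⟨p.totalDegree + 1, fun I hI => ?_⟩
        simp only [RingHom.comp_apply, MvPolynomial.coeToMvPowerSeries.ringHom_apply,
          MvPolynomial.coeff_coe, MvPolynomial.coeff_map]
        rw [MvPolynomial.coeff_eq_zero_of_totalDegree_lt]
        · simp
        · exact Nat.lt_of_succ_le hI

theorem coe_ofPoly (p : MvPolynomial (Fin n) v.integers) :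
    (ofPoly v n p : MvPowerSeries (Fin n) K) = (p.map v.integers.subtype :) := rfl

theorem coeff_ofPoly (p : MvPolynomial (Fin n) v.integers) (I : Fin n →₀ ℕ) :
    MvPowerSeries.coeff I (ofPoly v n p : MvPowerSeries (Fin n) K) = ((MvPolynomial.coeff I p : v.integers) : K) := by
  rw [coe_ofPoly, MvPolynomial.coeff_coe, MvPolynomial.coeff_map]
  rfl

variable (v n) in
/-- Constant integral convergent power series. -/
noncomputable def const : v.integers →+* integralConvergentSeries v n :=
  (ofPoly v n).comp MvPolynomial.C

theorem coe_const (a : v.integers) :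
    (const v n a : MvPowerSeries (Fin n) K) = MvPowerSeries.C (a : K) := by
  rw [const, RingHom.comp_apply, coe_ofPoly, MvPolynomial.map_C, MvPolynomial.coe_C]
  rfl

theorem const_ne_zero {c : v.integers} (hc : c ≠ 0) : const v n c ≠ 0 := by
  intro h
  have := congrArg (fun f => MvPowerSeries.coeff 0 ((f : integralConvergentSeries v n) : MvPowerSeries (Fin n) K)) h
  simp only [coe_const] at this
  simp at this
  exact hc this

/-- Dividing by `c` lowers every coefficient's valuation by the same finite amount, which preserves
decay. -/
theorem const_dvd_iff {c : v.integers} (hc : c ≠ 0) {f : integralConvergentSeries v n} :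
    const v n c ∣ f ↔ ∀ I, v (c : K) ≤ v (MvPowerSeries.coeff I (f : MvPowerSeries (Fin n) K)) := by
  have hc' : (c : K) ≠ 0 := by simpa using hc
  constructor
  · rintro ⟨g, rfl⟩ I
    rw [Subring.coe_mul, coe_const, MvPowerSeries.coeff_C_mul, v.map_mul]
    exact le_add_of_nonneg_right (g.2.1 I)
  · intro h
    have hco : ∀ I, MvPowerSeries.coeff I
        (MvPowerSeries.C (c : K)⁻¹ * (f : MvPowerSeries (Fin n) K)) =
        MvPowerSeries.coeff I (f : MvPowerSeries (Fin n) K) / c := fun I => by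
      rw [MvPowerSeries.coeff_C_mul, div_eq_inv_mul]
    refine ⟨mk (MvPowerSeries.C (c : K)⁻¹ * (f : MvPowerSeries (Fin n) K)) (fun I => ?_)
      (fun M => ?_), Subtype.ext ?_⟩
    · rw [hco]
      exact div_mem_integers hc' (h I)
    · obtain ⟨r, hr⟩ := exists_real_eq (v := v) hc'
      obtain ⟨N, hN⟩ := f.2.2 (M + r)
      refine ⟨N, fun I hI => ?_⟩
      have h1 := hN I hI
      rw [← div_mul_cancel₀ (MvPowerSeries.coeff I (f : MvPowerSeries (Fin n) K)) hc', ← hco,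
        v.map_mul, hr, WithTop.coe_add] at h1
      exact (WithTop.add_le_add_iff_right WithTop.coe_ne_top).mp h1
    · rw [Subring.coe_mul, coe_const]
      change _ = _ * (_ * _)
      rw [← mul_assoc, ← map_mul, mul_inv_cancel₀ hc', map_one, one_mul]

/-- Integral convergent power series are approximated by polynomials. -/
theorem exists_dvd_sub_ofPoly {c : v.integers} (hc : c ≠ 0) (f : integralConvergentSeries v n) :
    ∃ p, const v n c ∣ f - ofPoly v n p := by
  classical
  obtain ⟨r, hr⟩ := exists_real_eq (v := v) (a := (c : K)) (by simpa using hc)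
  obtain ⟨N, hN⟩ := f.2.2 r
  -- Coefficients outside `s` have degree at least `N`, hence valuation at least `r = v c`, so
  -- truncating to `s` suffices.
  let s : Finset (Fin n →₀ ℕ) := (Finsupp.finite_of_degree_le N).toFinset
  refine ⟨∑ I ∈ s, MvPolynomial.monomial I
    ⟨MvPowerSeries.coeff I (f : MvPowerSeries (Fin n) K), f.2.1 I⟩, (const_dvd_iff hc).mpr
    fun I => ?_⟩
  rw [AddSubgroupClass.coe_sub, map_sub, coeff_ofPoly, MvPolynomial.coeff_sum]
  simp only [MvPolynomial.coeff_monomial, Finset.sum_ite_eq']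
  by_cases hI : I ∈ s
  · simp [hI]
  · have : N ≤ I.degree := by
      simp only [s, Set.Finite.mem_toFinset, Set.mem_ofPred_eq, not_le] at hI
      exact hI.le
    simpa [hI, hr] using hN I this

end IntegralConvergentSeries

namespace IntegralConvergentSeries

variable {K : Type*} [Field K] {v : AddValuation K (WithTop ℝ)} {n : ℕ}

theorem nonneg_coe (a : v.integers) : 0 ≤ v (a : K) := a.2

theorem const_pow_dvd_iff {c : v.integers} (hc : c ≠ 0) {f : integralConvergentSeries v n}
    (N : ℕ) : const v n c ^ N ∣ f ↔
      ∀ I, v ((c : K) ^ N) ≤ v (MvPowerSeries.coeff I (f : MvPowerSeries (Fin n) K)) := by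
  rw [← map_pow, const_dvd_iff (pow_ne_zero _ hc)]
  rfl

/-! ### Adic completeness of the series ring -/

/-- The ring of integral convergent power series is adically complete. -/
theorem isAdicComplete (hK : IsCompleteFor v) {c : v.integers} (hc : c ≠ 0) (hc' : 0 < v (c : K)) :
    IsAdicComplete (Ideal.span {const v n c}) (integralConvergentSeries v n) := by
  refine { haus' := fun f hf => ?_, prec' := fun f hf => ?_ }
  · refine Subtype.ext (MvPowerSeries.ext fun I => eq_zero_of_forall_le (v := v) fun M => ?_)
    obtain ⟨N, hN⟩ := exists_le_pow hc' M
    have := hf N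
    rw [SModEq.zero, smul_eq_mul, Ideal.mul_top, Ideal.span_singleton_pow,
      Ideal.mem_span_singleton, const_pow_dvd_iff hc] at this
    exact hN.trans (this I)
  · have hf' : ∀ {i j}, i ≤ j → ∀ I, v ((c : K) ^ i) ≤
        v (MvPowerSeries.coeff I (f i : MvPowerSeries (Fin n) K) -
          MvPowerSeries.coeff I (f j : MvPowerSeries (Fin n) K)) := fun {i j} hij I => by
      have := hf hij
      rw [SModEq.sub_mem, smul_eq_mul, Ideal.mul_top, Ideal.span_singleton_pow,
        Ideal.mem_span_singleton, const_pow_dvd_iff hc] at this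
      simpa using this I
    have hL : ∀ I, ∃ a : K, ∀ M : ℝ, ∃ N : ℕ, ∀ i : ℕ, N ≤ i →
        (M : WithTop ℝ) ≤ v (MvPowerSeries.coeff I (f i : MvPowerSeries (Fin n) K) - a) := by
      refine fun I => hK _ fun M => ?_
      obtain ⟨N, hN⟩ := exists_le_pow hc' M
      refine ⟨N, fun i j hi hj => ?_⟩
      rw [← sub_sub_sub_cancel_left _ _
        (MvPowerSeries.coeff I (f N : MvPowerSeries (Fin n) K))]
      exact v.map_le_sub (hN.trans (hf' hj I)) (hN.trans (hf' hi I))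
    choose L hL using hL
    -- The coefficientwise limits are approached uniformly in `I`: the index `j` depends on `I`, but
    -- by the ultrametric inequality the bound does not.
    have hfL : ∀ N I, v ((c : K) ^ N) ≤
        v (MvPowerSeries.coeff I (f N : MvPowerSeries (Fin n) K) - L I) := by
      intro N I
      obtain ⟨r, hr⟩ := exists_real_eq (v := v) (a := (c : K) ^ N)
        (pow_ne_zero _ (by simpa using hc))
      obtain ⟨j, hj⟩ := hL I r
      rw [← sub_add_sub_cancel _ (MvPowerSeries.coeff I
        (f (max N j) : MvPowerSeries (Fin n) K)) (L I)]
      exact v.map_le_add (hf' (le_max_left _ _) I) (hr.trans_le (hj _ (le_max_right _ _)))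
    let g : MvPowerSeries (Fin n) K := L
    have hg : ∀ I, MvPowerSeries.coeff I g = L I := fun I => rfl
    refine ⟨mk g (fun I => ?_) (fun M => ?_), fun N => ?_⟩
    · rw [hg, ← sub_sub_cancel (MvPowerSeries.coeff I (f 0 : MvPowerSeries (Fin n) K)) (L I)]
      exact v.map_le_sub ((f 0).2.1 I) (by simpa using hfL 0 I)
    -- The limit inherits decay from a single `f k` that agrees with it up to valuation `M`.
    · obtain ⟨k, hk⟩ := exists_le_pow hc' M
      obtain ⟨N, hN⟩ := (f k).2.2 M
      refine ⟨N, fun I hI => ?_⟩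
      rw [hg, ← sub_sub_cancel (MvPowerSeries.coeff I (f k : MvPowerSeries (Fin n) K)) (L I)]
      exact v.map_le_sub (hN I hI) (hk.trans (hfL k I))
    · rw [SModEq.sub_mem, smul_eq_mul, Ideal.mul_top, Ideal.span_singleton_pow,
        Ideal.mem_span_singleton, const_pow_dvd_iff hc]
      intro I
      rw [AddSubgroupClass.coe_sub, map_sub]
      exact hfL N I

/-! ### Substitution of polynomials into convergent series -/

variable {m : ℕ} (a : Fin m → MvPolynomial (Fin n) v.integers)

theorem hasSubst (ha : ∀ i, (a i).constantCoeff = 0) :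
    MvPowerSeries.HasSubst fun i => (ofPoly v n (a i) : MvPowerSeries (Fin n) K) := by
  refine MvPowerSeries.hasSubst_of_constantCoeff_zero fun i => ?_
  rw [← MvPowerSeries.coeff_zero_eq_constantCoeff_apply, coeff_ofPoly]
  have := ha i
  rw [MvPolynomial.constantCoeff_eq] at this
  rw [this]
  rfl

theorem coeff_prod_pow_ofPoly (d : Fin m →₀ ℕ) (e : Fin n →₀ ℕ) :
    MvPowerSeries.coeff e
      (d.prod fun i k => (ofPoly v n (a i) : MvPowerSeries (Fin n) K) ^ k) =
    ((MvPolynomial.coeff e (d.prod fun i k => a i ^ k) : v.integers) : K) := by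
  rw [← coeff_ofPoly, Finsupp.prod, Finsupp.prod]
  congr 1
  rw [map_prod, ← Subring.coe_subtype, map_prod]
  simp

theorem totalDegree_prod_pow_le (d : Fin m →₀ ℕ) :
    (d.prod fun i k => a i ^ k).totalDegree ≤
      d.degree * Finset.univ.sup fun i => (a i).totalDegree := by
  refine (MvPolynomial.totalDegree_finsetProd _ _).trans ?_
  rw [Finsupp.degree_apply, Finset.sum_mul]
  refine Finset.sum_le_sum fun i _ => (MvPolynomial.totalDegree_pow _ _).trans ?_
  exact Nat.mul_le_mul_left _ (Finset.le_sup (f := fun i => (a i).totalDegree) (Finset.mem_univ i))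

theorem le_map_finsum {ι : Type*} {g : WithTop ℝ} {f : ι → K} (h : ∀ i, g ≤ v (f i)) :
    g ≤ v (∑ᶠ i, f i) := by
  classical
  rw [finsum_def]
  split_ifs
  · exact v.map_le_sum fun i _ => h i
  · simp

/-- Substitution of polynomials without constant term into integral convergent power series. -/
noncomputable def substHom (ha : ∀ i, (a i).constantCoeff = 0) :
    integralConvergentSeries v m →+* integralConvergentSeries v n :=
  ((MvPowerSeries.substAlgHom (hasSubst a ha) : _ →ₐ[K] _).toRingHom.comp
    (integralConvergentSeries v m).subtype).codRestrict _ fun f => by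
      have hc : ∀ e, MvPowerSeries.coeff e
          (((MvPowerSeries.substAlgHom (hasSubst a ha) : _ →ₐ[K] _).toRingHom.comp
            (integralConvergentSeries v m).subtype) f) =
          ∑ᶠ d, MvPowerSeries.coeff d (f : MvPowerSeries (Fin m) K) *
            ((MvPolynomial.coeff e (d.prod fun i k => a i ^ k) : v.integers) : K) := fun e => by
        simp only [← coeff_prod_pow_ofPoly]
        exact (congrArg _ (MvPowerSeries.substAlgHom_apply (hasSubst a ha) _)).trans
          (MvPowerSeries.coeff_subst (hasSubst a ha) _ e)
      refine ⟨fun e => ?_, fun M => ?_⟩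
      · rw [hc]
        refine le_map_finsum fun d => ?_
        rw [v.map_mul]
        exact add_nonneg (f.2.1 d) (nonneg_coe (MvPolynomial.coeff e _))
      · obtain ⟨N, hN⟩ := f.2.2 M
        -- A monomial of degree below `N` becomes a polynomial of degree at most `N` times the
        -- largest `totalDegree`, so beyond that bound only coefficients of `f` in degree at least
        -- `N` contribute.
        refine ⟨N * (Finset.univ.sup fun i => (a i).totalDegree) + 1, fun e he => ?_⟩
        rw [hc]
        refine le_map_finsum fun d => ?_
        rcases le_or_gt N d.degree with h | h
        · rw [v.map_mul]
          exact le_trans (hN d h) (le_add_of_nonneg_right (nonneg_coe (MvPolynomial.coeff e _)))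
        · rw [MvPolynomial.coeff_eq_zero_of_totalDegree_lt]
          · simp
          · refine (totalDegree_prod_pow_le a d).trans_lt (lt_of_lt_of_le ?_ he)
            exact Nat.lt_succ_of_le (Nat.mul_le_mul_right _ h.le)

theorem coe_substHom (ha : ∀ i, (a i).constantCoeff = 0) (f : integralConvergentSeries v m) :
    (substHom a ha f : MvPowerSeries (Fin n) K) =
      MvPowerSeries.subst (fun i => (ofPoly v n (a i) : MvPowerSeries (Fin n) K))
        (f : MvPowerSeries (Fin m) K) :=
  MvPowerSeries.substAlgHom_apply (R := K) (S := K) (hasSubst a ha) (f : MvPowerSeries (Fin m) K)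

theorem substHom_ofPoly (ha : ∀ i, (a i).constantCoeff = 0)
    (p : MvPolynomial (Fin m) v.integers) :
    substHom a ha (ofPoly v m p) = ofPoly v n (MvPolynomial.aeval a p) := by
  have : (substHom a ha).comp (ofPoly v m) =
      (ofPoly v n).comp (MvPolynomial.aeval a).toRingHom := by
    refine MvPolynomial.ringHom_ext (fun r => ?_) (fun i => ?_)
    · refine Subtype.ext ?_
      simp [coe_substHom, coe_ofPoly, MvPowerSeries.subst_C]
    · refine Subtype.ext ?_
      simp [coe_substHom, coe_ofPoly]
      exact MvPowerSeries.subst_X (hasSubst a ha) i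
  exact RingHom.congr_fun this p

theorem substHom_const (ha : ∀ i, (a i).constantCoeff = 0) (c : v.integers) :
    substHom a ha (const v m c) = const v n c := by
  simp [const, substHom_ofPoly]

end IntegralConvergentSeries

/-! ### Noether normalization lifted from the residue field -/

/-- A form of Noether normalization lifted along a surjection `O → k` onto a field. -/
theorem MvPolynomial.exists_lift_noether_normalization {O k : Type*} [CommRing O] [Field k]
    (ρ : O →+* k) (hρ : Function.Surjective ρ) {n : ℕ} (p : MvPolynomial (Fin n) O)
    (hp : MvPolynomial.map ρ p ≠ 0) (hu : ¬ IsUnit (MvPolynomial.map ρ p)) :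
    ∃ s < n, ∃ a : Fin s → MvPolynomial (Fin n) O, (∀ i, (a i).constantCoeff = 0) ∧
      ∀ j : Fin n, ∃ G : Polynomial (MvPolynomial (Fin s) O), G.Monic ∧
        ∃ q, MvPolynomial.map ρ
          (G.eval₂ (MvPolynomial.aeval a : _ →ₐ[O] MvPolynomial (Fin n) O).toRingHom
            (MvPolynomial.X j) - q * p) = 0 := by
  set I : Ideal (MvPolynomial (Fin n) k) := Ideal.span {MvPolynomial.map ρ p} with hI
  have hItop : I ≠ ⊤ := fun h => hu (Ideal.span_singleton_eq_top.mp h)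
  obtain ⟨s, -, g, hginj, hgint⟩ := exists_integral_inj_algHom_of_quotient I hItop
  -- The polynomial ring in `s` variables embeds integrally in a quotient by a nonzero polynomial,
  -- which has dimension at most `n - 1`.
  have hs : s < n := by
    have h1 := ringKrullDim_le_of_isIntegral_of_injective g.toRingHom hgint hginj
    have h2 := ringKrullDim_quotient_succ_le_of_nonZeroDivisor
      (mem_nonZeroDivisors_of_ne_zero hp)
    rw [MvPolynomial.ringKrullDim_of_isNoetherianRing, ringKrullDim_eq_zero_of_field] at h1 h2
    simp only [Nat.card_eq_fintype_card, Fintype.card_fin, zero_add] at h1 h2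
    have h3 : (s : WithBot ℕ∞) + 1 ≤ n := le_trans (by gcongr) h2
    exact_mod_cast h3
  have hsurj : Function.Surjective (MvPolynomial.map (σ := Fin n) ρ) :=
    MvPolynomial.map_surjective _ hρ
  have hb : ∀ i, ∃ b, Ideal.Quotient.mk I (MvPolynomial.map ρ b) = g (MvPolynomial.X i) :=
    fun i => by
      obtain ⟨b', hb'⟩ := Ideal.Quotient.mk_surjective (g (MvPolynomial.X i))
      obtain ⟨b, hb⟩ := hsurj b'
      exact ⟨b, by rw [hb, hb']⟩
  choose b hb using hb
  -- Constant terms are removed so that the `a i` can be substituted into power series. This only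
  -- translates the variables by `τ`, so integrality of `g = g' ∘ τ` passes to `g'`.
  let a : Fin s → MvPolynomial (Fin n) O := fun i => b i - MvPolynomial.C (b i).constantCoeff
  let g' : MvPolynomial (Fin s) k →ₐ[k] (MvPolynomial (Fin n) k ⧸ I) :=
    MvPolynomial.aeval fun i => Ideal.Quotient.mk I (MvPolynomial.map ρ (a i))
  let τ : MvPolynomial (Fin s) k →ₐ[k] MvPolynomial (Fin s) k :=
    MvPolynomial.aeval fun i => MvPolynomial.X i + MvPolynomial.C (ρ (b i).constantCoeff)
  have hgτ : g = g'.comp τ := by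
    refine MvPolynomial.algHom_ext fun i => ?_
    rw [← hb i, AlgHom.comp_apply, MvPolynomial.aeval_X, map_add, MvPolynomial.aeval_X,
      ← MvPolynomial.algebraMap_eq, AlgHom.commutes, map_sub, map_sub, MvPolynomial.map_C]
    exact (sub_add_cancel _ _).symm
  have hg'int : g'.toRingHom.IsIntegral := by
    refine RingHom.IsIntegral.tower_top τ.toRingHom g'.toRingHom ?_
    rw [hgτ] at hgint
    exact hgint
  refine ⟨s, hs, a, fun i => by simp [a], fun j => ?_⟩
  obtain ⟨G', hG', hG'0⟩ := hg'int (Ideal.Quotient.mk I (MvPolynomial.X j))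
  have hlift : G' ∈ Polynomial.lifts (MvPolynomial.map (σ := Fin s) ρ) := by
    rw [Polynomial.lifts_iff_coeff_lifts]
    exact fun i => MvPolynomial.map_surjective _ hρ _
  obtain ⟨G, hG, -, hGm⟩ := Polynomial.lifts_and_degree_eq_and_monic hlift hG'
  have hcomm : ((Ideal.Quotient.mk I).comp (MvPolynomial.map ρ)).comp
      (MvPolynomial.aeval a : _ →ₐ[O] MvPolynomial (Fin n) O).toRingHom =
      g'.toRingHom.comp (MvPolynomial.map ρ) := by
    refine MvPolynomial.ringHom_ext (fun r => ?_) (fun i => ?_)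
    · simp [g']
      rfl
    · simp [g']
  have hmem : MvPolynomial.map ρ
      (G.eval₂ (MvPolynomial.aeval a : _ →ₐ[O] MvPolynomial (Fin n) O).toRingHom
            (MvPolynomial.X j)) ∈ I := by
    rw [← Ideal.Quotient.eq_zero_iff_mem, ← RingHom.comp_apply, Polynomial.hom_eval₂, hcomm,
      ← hG'0, ← hG, Polynomial.eval₂_map]
    simp
  obtain ⟨q', hq'⟩ := Ideal.mem_span_singleton'.mp hmem
  obtain ⟨q, rfl⟩ := hsurj q'
  exact ⟨G, hGm, q, by rw [map_sub, map_mul, hq', sub_self]⟩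

/-! ### Finiteness of quotients by primitive series -/

namespace IntegralConvergentSeries

variable {K : Type*} [Field K] {v : AddValuation K (WithTop ℝ)} {n : ℕ}

theorem map_residue_eq_zero_iff {p : MvPolynomial (Fin n) v.integers} :
    MvPolynomial.map (IsLocalRing.residue v.integers) p = 0 ↔
      ∀ I, 0 < v ((MvPolynomial.coeff I p : v.integers) : K) := by
  rw [MvPolynomial.ext_iff]
  simp only [MvPolynomial.coeff_map, MvPolynomial.coeff_zero, residue_eq_zero_iff]

/-- Finitely many polynomials with coefficients in the maximal ideal have a common nonzero constant
divisor in the maximal ideal. -/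
theorem exists_common_divisor_poly (hv : ∃ a : K, a ≠ 0 ∧ v a ≠ 0) {ι : Type*} [Fintype ι]
    (r : ι → MvPolynomial (Fin n) v.integers)
    (hr : ∀ i, MvPolynomial.map (IsLocalRing.residue v.integers) (r i) = 0)
    (b : v.integers) (hb : 0 < v (b : K)) :
    ∃ c : v.integers, c ≠ 0 ∧ 0 < v (c : K) ∧ c ∣ b ∧ ∀ i, MvPolynomial.C c ∣ r i := by
  classical
  obtain ⟨c, hc, hc', h⟩ := exists_common_divisor hv
    (insert b (Finset.univ.biUnion fun i => (r i).support.image fun I => (r i).coeff I)) (by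
      simp only [Finset.mem_insert, Finset.mem_biUnion, Finset.mem_image]
      rintro a (rfl | ⟨i, -, I, -, rfl⟩)
      · exact hb
      · exact map_residue_eq_zero_iff.mp (hr i) I)
  refine ⟨c, hc, hc', h b (Finset.mem_insert_self _ _), fun i => ?_⟩
  rw [MvPolynomial.C_dvd_iff_dvd_coeff]
  intro I
  by_cases hI : I ∈ (r i).support
  · refine h _ (Finset.mem_insert_of_mem (Finset.mem_biUnion.mpr ⟨i, Finset.mem_univ _, ?_⟩))
    exact Finset.mem_image_of_mem _ hI
  · rw [MvPolynomial.notMem_support_iff.mp hI]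
    exact dvd_zero _

/-- The quotient by a primitive series that is not a unit is finite over a ring of integral
convergent power series in fewer variables. -/
theorem exists_finite_of_primitive (hv : ∃ a : K, a ≠ 0 ∧ v a ≠ 0) (hK : IsCompleteFor v)
    (f : integralConvergentSeries v n) (hf : ¬ IsUnit f)
    (hprim : ∃ I, v (MvPowerSeries.coeff I (f : MvPowerSeries (Fin n) K)) = 0) :
    ∃ s < n, ∃ φ : integralConvergentSeries v s →+* integralConvergentSeries v n,
      ((Ideal.Quotient.mk (Ideal.span {f})).comp φ).Finite := by
  obtain ⟨b, hb, hb'⟩ := exists_pos hv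
  obtain ⟨p, hp⟩ := exists_dvd_sub_ofPoly hb f
  have hp0 : MvPolynomial.map (IsLocalRing.residue v.integers) p ≠ 0 := by
    intro h
    obtain ⟨I, hI⟩ := hprim
    have h1 := map_residue_eq_zero_iff.mp h I
    have h2 := (const_dvd_iff hb).mp hp I
    rw [AddSubgroupClass.coe_sub, map_sub, coeff_ofPoly] at h2
    have h3 := v.map_lt_add (hb'.trans_le h2) h1
    rw [sub_add_cancel, hI] at h3
    exact h3.false
  -- If `p` is a unit modulo the maximal ideal, then some multiple of `f` is 1 modulo `c`; as `c`
  -- lies in the Jacobson radical by completeness, `f` would be a unit.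
  by_cases hu : IsUnit (MvPolynomial.map (IsLocalRing.residue v.integers) p)
  · obtain ⟨q', hq'⟩ := isUnit_iff_exists_inv'.mp hu
    obtain ⟨q, rfl⟩ := MvPolynomial.map_surjective _ IsLocalRing.residue_surjective q'
    obtain ⟨c, hc, hc', hcb, hcr⟩ := exists_common_divisor_poly hv (fun _ : Unit => q * p - 1)
      (fun _ => by rw [map_sub, map_mul, hq', map_one, sub_self]) b hb'
    have := isAdicComplete (n := n) hK hc hc'
    have hdvd : const v n c ∣ ofPoly v n q * f - 1 := by
      have h1 : const v n c ∣ ofPoly v n q * (f - ofPoly v n p) :=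
        ((map_dvd (const v n) hcb).trans hp).mul_left _
      have h2 : const v n c ∣ ofPoly v n (q * p - 1) := map_dvd (ofPoly v n) (hcr ())
      have h3 := dvd_add h1 h2
      rwa [map_sub, map_mul, map_one, mul_sub, sub_add_sub_cancel] at h3
    have hunit : IsUnit (ofPoly v n q * f) := by
      have h1 := IsAdicComplete.le_jacobson_bot (Ideal.span {const v n c})
        (Ideal.mem_span_singleton.mpr hdvd)
      have h2 := Ideal.mem_jacobson_bot.mp h1 1
      rwa [mul_one, sub_add_cancel] at h2
    exact absurd (isUnit_of_mul_isUnit_right hunit) hf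
  obtain ⟨s, hs, a, ha, hG⟩ := MvPolynomial.exists_lift_noether_normalization
    (IsLocalRing.residue v.integers) IsLocalRing.residue_surjective p hp0 hu
  choose G hGm q hq using hG
  -- Besides the `n` error polynomials, `c` must divide `b`, so that `f` and `p` still agree modulo
  -- `c`.
  obtain ⟨c, hc, hc', hcb, hcr⟩ := exists_common_divisor_poly hv _ hq b hb'
  refine ⟨s, hs, substHom a ha, ?_⟩
  algebraize [substHom a ha]
  have halg : ∀ x, algebraMap (integralConvergentSeries v s) (integralConvergentSeries v n) x =
    substHom a ha x := fun _ => rfl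
  have hcc : algebraMap (integralConvergentSeries v s) (integralConvergentSeries v n)
      (const v s c) = const v n c := substHom_const a ha c
  have := isAdicComplete (n := s) hK hc hc'
  have : IsAdicComplete (Ideal.span {algebraMap (integralConvergentSeries v s)
      (integralConvergentSeries v n) (const v s c)}) (integralConvergentSeries v n) := by
    rw [hcc]
    exact isAdicComplete hK hc hc'
  have hfin : Module.Finite (integralConvergentSeries v s) (integralConvergentSeries v n ⧸
      Ideal.span {f, algebraMap (integralConvergentSeries v s)
      (integralConvergentSeries v n) (const v s c)}) := by
    rw [hcc]
    set J : Ideal (integralConvergentSeries v n) := Ideal.span {f, const v n c} with hJ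
    have hfJ : f ∈ J := Ideal.subset_span (by simp)
    have hcJ : const v n c ∈ J := Ideal.subset_span (by simp)
    have hpJ : ofPoly v n p ∈ J := by
      rw [← sub_sub_cancel f (ofPoly v n p)]
      exact J.sub_mem hfJ (J.mem_of_dvd ((map_dvd (const v n) hcb).trans hp) hcJ)
    let x : Fin n → integralConvergentSeries v n ⧸ J :=
      fun j => Ideal.Quotient.mk J (ofPoly v n (MvPolynomial.X j))
    have hint : ∀ j, IsIntegral (integralConvergentSeries v s) (x j) := by
      intro j
      refine ⟨(G j).map (ofPoly v s), (hGm j).map _, ?_⟩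
      have hcomm : (algebraMap (integralConvergentSeries v s)
          (integralConvergentSeries v n ⧸ J)).comp (ofPoly v s) =
          ((Ideal.Quotient.mk J).comp (ofPoly v n)).comp
            (MvPolynomial.aeval a : _ →ₐ[v.integers] _).toRingHom := by
        refine RingHom.ext fun y => ?_
        exact congrArg (Ideal.Quotient.mk J) (substHom_ofPoly a ha y)
      rw [Polynomial.eval₂_map, hcomm]
      have hx : x j = ((Ideal.Quotient.mk J).comp (ofPoly v n)) (MvPolynomial.X j) := rfl
      rw [hx, ← Polynomial.hom_eval₂, RingHom.comp_apply, Ideal.Quotient.eq_zero_iff_mem]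
      have h1 : ofPoly v n _ ∈ J := J.mem_of_dvd (map_dvd (ofPoly v n) (hcr j)) hcJ
      rw [map_sub, map_mul] at h1
      exact (J.sub_mem_iff_left (J.mul_mem_left _ hpJ)).mp h1
    -- Modulo `c` every series is a polynomial, so the integral elements `x j` generate the quotient
    -- as an algebra.
    have htop : Algebra.adjoin (integralConvergentSeries v s) (Set.range x) = ⊤ := by
      rw [eq_top_iff]
      rintro y -
      obtain ⟨h, rfl⟩ := Ideal.Quotient.mk_surjective y
      obtain ⟨r, hr⟩ := exists_dvd_sub_ofPoly hc h
      rw [Ideal.Quotient.eq.mpr (J.mem_of_dvd hr hcJ)]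
      clear hr
      induction r using MvPolynomial.induction_on with
      | C t =>
        have : Ideal.Quotient.mk J (ofPoly v n (MvPolynomial.C t)) =
            algebraMap (integralConvergentSeries v s) _ (const v s t) :=
          congrArg (Ideal.Quotient.mk J) (substHom_const a ha t).symm
        rw [this]
        exact Subalgebra.algebraMap_mem _ _
      | add r₁ r₂ h₁ h₂ =>
        rw [map_add, map_add]
        exact Subalgebra.add_mem _ h₁ h₂
      | mul_X r j h₁ =>
        rw [map_mul, map_mul]
        exact Subalgebra.mul_mem _ h₁ (Algebra.subset_adjoin ⟨j, rfl⟩)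
    refine ⟨?_⟩
    rw [← Algebra.top_toSubmodule, ← htop]
    refine fg_adjoin_of_finite (Set.finite_range x) ?_
    rintro _ ⟨j, rfl⟩
    exact hint j
  have := Module.Finite.quotient_span_of_isAdicComplete (const v s c) f
  exact this

end IntegralConvergentSeries

/-! ### The two dimension bounds -/

namespace IntegralConvergentSeries

variable {K : Type*} [Field K] {v : AddValuation K (WithTop ℝ)} {n : ℕ}

/-- A nonzero series is a nonzero constant times a primitive series. -/
theorem exists_eq_const_mul (f : integralConvergentSeries v n) (hf : f ≠ 0) :
    ∃ (c : v.integers) (g : integralConvergentSeries v n), c ≠ 0 ∧ f = const v n c * g ∧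
      ∃ I, v (MvPowerSeries.coeff I (g : MvPowerSeries (Fin n) K)) = 0 := by
  obtain ⟨I₀, hI₀⟩ : ∃ I, MvPowerSeries.coeff I (f : MvPowerSeries (Fin n) K) ≠ 0 := by
    by_contra! h
    exact hf (Subtype.ext (MvPowerSeries.ext h))
  obtain ⟨r, hr⟩ := exists_real_eq (v := v) hI₀
  obtain ⟨N, hN⟩ := f.2.2 r
  -- The minimum over this finite set is global: outside it valuations are at least `r`, the value
  -- at `I₀`, which is why `I₀` is inserted.
  let s : Finset (Fin n →₀ ℕ) := insert I₀ (Finsupp.finite_of_degree_le N).toFinset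
  obtain ⟨I, -, hI⟩ := s.exists_min_image
    (fun I => v (MvPowerSeries.coeff I (f : MvPowerSeries (Fin n) K))) ⟨I₀, by simp [s]⟩
  have hmin : ∀ J, v (MvPowerSeries.coeff I (f : MvPowerSeries (Fin n) K)) ≤
      v (MvPowerSeries.coeff J (f : MvPowerSeries (Fin n) K)) := fun J => by
    by_cases hJ : J ∈ s
    · exact hI J hJ
    · have : N ≤ J.degree := by
        simp only [s, Finset.mem_insert, Set.Finite.mem_toFinset, Set.mem_ofPred_eq, not_le,
          not_or] at hJ
        exact hJ.2.le
      exact (hI I₀ (by simp [s])).trans (hr.trans_le (hN J this))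
  let c : v.integers := ⟨MvPowerSeries.coeff I (f : MvPowerSeries (Fin n) K), f.2.1 I⟩
  have hcv : v (c : K) ≠ ⊤ := ((hmin I₀).trans_lt (hr ▸ WithTop.coe_lt_top r)).ne
  have hc : c ≠ 0 := fun h => hcv (by rw [h]; simp)
  obtain ⟨g, hg⟩ := (const_dvd_iff hc).mpr hmin
  refine ⟨c, g, hc, hg, I, ?_⟩
  have h1 : v (c : K) = v (c : K) +
      v (MvPowerSeries.coeff I (g : MvPowerSeries (Fin n) K)) := by
    rw [← v.map_mul, ← MvPowerSeries.coeff_C_mul, ← coe_const, ← Subring.coe_mul, ← hg]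
  refine (WithTop.add_right_inj hcv).mp ?_
  rw [add_comm, ← h1, zero_add]

/-- Every constant of positive valuation has a power divisible by `c`, so it lies in `P`. The
quotient is thus an algebra over the residue field, generated by the images of the variables because
series are polynomials modulo `c`. -/
theorem ringKrullDim_quotient_le_of_const_mem (P : Ideal (integralConvergentSeries v n))
    [hP : P.IsPrime] {c : v.integers} (hc : c ≠ 0) (hcP : const v n c ∈ P) :
    ringKrullDim (integralConvergentSeries v n ⧸ P) ≤ n := by
  have hmem : ∀ a : v.integers, 0 < v (a : K) → const v n a ∈ P := by
    intro a ha
    obtain ⟨r, hr⟩ := exists_real_eq (v := v) (a := (c : K)) (by simpa using hc)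
    obtain ⟨N, hN⟩ := exists_le_pow ha r
    refine hP.mem_of_pow_mem N ?_
    rw [← map_pow]
    refine P.mem_of_dvd (map_dvd (const v n) (dvd_of_le hc ?_)) hcP
    rw [hr]
    exact hN
  let ψ : IsLocalRing.ResidueField v.integers →+* integralConvergentSeries v n ⧸ P :=
    Ideal.Quotient.lift _ ((Ideal.Quotient.mk P).comp (const v n)) fun a ha => by
      rw [RingHom.comp_apply, Ideal.Quotient.eq_zero_iff_mem]
      exact hmem a (residue_eq_zero_iff.mp ((IsLocalRing.residue_eq_zero_iff a).mpr ha))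
  let χ : MvPolynomial (Fin n) (IsLocalRing.ResidueField v.integers) →+*
      integralConvergentSeries v n ⧸ P :=
    MvPolynomial.eval₂Hom ψ fun i => Ideal.Quotient.mk P (ofPoly v n (MvPolynomial.X i))
  have hχ : χ.comp (MvPolynomial.map (IsLocalRing.residue v.integers)) =
      (Ideal.Quotient.mk P).comp (ofPoly v n) := by
    refine MvPolynomial.ringHom_ext (fun r => ?_) (fun i => ?_)
    · simp [χ]
      rfl
    · simp [χ]
  have hsurj : Function.Surjective χ := by
    intro y
    obtain ⟨f, rfl⟩ := Ideal.Quotient.mk_surjective y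
    obtain ⟨p, hp⟩ := exists_dvd_sub_ofPoly hc f
    refine ⟨MvPolynomial.map (IsLocalRing.residue v.integers) p, ?_⟩
    rw [Ideal.Quotient.eq.mpr (P.mem_of_dvd hp hcP), ← RingHom.comp_apply, hχ,
      RingHom.comp_apply]
  refine (ringKrullDim_le_of_surjective χ hsurj).trans ?_
  rw [MvPolynomial.ringKrullDim_of_isNoetherianRing, ringKrullDim_eq_zero_of_field]
  simp

theorem ringKrullDim_le (hv : ∃ a : K, a ≠ 0 ∧ v a ≠ 0) (hK : IsCompleteFor v) (n : ℕ) :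
    ringKrullDim (integralConvergentSeries v n) ≤ (n : WithBot ℕ∞) + 1 := by
  induction n using Nat.strong_induction_on with
  | h n ih =>
    have : IsDomain (integralConvergentSeries v n) := NoZeroDivisors.to_isDomain _
    refine ringKrullDim_le_of_forall_quotient n fun P hP hP0 => ?_
    obtain ⟨f, hfP, hf⟩ := Submodule.exists_mem_ne_zero_of_ne_bot hP0
    obtain ⟨c, g, hc, rfl, hg⟩ := exists_eq_const_mul f hf
    rcases hP.mem_or_mem hfP with h | h
    · exact ringKrullDim_quotient_le_of_const_mem P hc h
    · have hgu : ¬ IsUnit g := fun hu => hP.ne_top (P.eq_top_of_isUnit_mem h hu)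
      obtain ⟨s, hs, φ, hφ⟩ := exists_finite_of_primitive hv hK g hgu hg
      have hle : Ideal.span {g} ≤ P := (Ideal.span_singleton_le_iff_mem P).mpr h
      have h1 := ringKrullDim_le_of_surjective (Ideal.Quotient.factor hle)
        (Ideal.Quotient.factor_surjective hle)
      refine h1.trans ((ringKrullDim_le_of_isIntegral _ hφ.to_isIntegral).trans
        ((ih s hs).trans ?_))
      exact_mod_cast hs

theorem one_le_ringKrullDim (hv : ∃ a : K, a ≠ 0 ∧ v a ≠ 0) :
    1 ≤ ringKrullDim (integralConvergentSeries v 0) := by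
  obtain ⟨c, hc, hc'⟩ := exists_pos hv
  have h := ringKrullDim_quotient_succ_le_of_nonZeroDivisor
    (mem_nonZeroDivisors_of_ne_zero (const_ne_zero (n := 0) hc))
  have : Nontrivial (integralConvergentSeries v 0 ⧸ Ideal.span {const v 0 c}) := by
    rw [Ideal.Quotient.nontrivial_iff, Ne, Ideal.eq_top_iff_one, Ideal.mem_span_singleton,
      const_dvd_iff hc]
    intro h
    have := h 0
    rw [OneMemClass.coe_one, MvPowerSeries.coeff_zero_one, v.map_one] at this
    exact absurd hc' this.not_gt
  refine le_trans ?_ h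
  exact le_add_of_nonneg_left ringKrullDim_nonneg_of_nontrivial

/-- Setting the first variable to zero is surjective, with the inclusion of the other variables as a
section, and it kills the non-zero-divisor `X 0`. -/
theorem ringKrullDim_succ_le (n : ℕ) :
    ringKrullDim (integralConvergentSeries v n) + 1 ≤
      ringKrullDim (integralConvergentSeries v (n + 1)) := by
  let a : Fin (n + 1) → MvPolynomial (Fin n) v.integers := Fin.cases 0 MvPolynomial.X
  let b : Fin n → MvPolynomial (Fin (n + 1)) v.integers := fun i => MvPolynomial.X i.succ
  have ha : ∀ i, (a i).constantCoeff = 0 := fun i => by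
    cases i using Fin.cases <;> simp [a]
  have hb : ∀ i, (b i).constantCoeff = 0 := fun i => by simp [b]
  have hX : ofPoly v (n + 1) (MvPolynomial.X 0) ≠ 0 := by
    intro h
    have := coeff_ofPoly (v := v) (MvPolynomial.X (0 : Fin (n + 1))) (Finsupp.single 0 1)
    rw [h, MvPolynomial.coeff_X] at this
    simp at this
  refine ringKrullDim_succ_le_of_surjective (substHom a ha) (fun f => ⟨substHom b hb f, ?_⟩)
    (mem_nonZeroDivisors_of_ne_zero hX) ?_
  · refine Subtype.ext ?_
    rw [coe_substHom, coe_substHom,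
      MvPowerSeries.subst_comp_subst_apply (hasSubst b hb) (hasSubst a ha)]
    have : (fun i => MvPowerSeries.subst
        (fun i => (ofPoly v n (a i) : MvPowerSeries (Fin n) K))
        (ofPoly v (n + 1) (b i) : MvPowerSeries (Fin (n + 1)) K)) = MvPowerSeries.X := by
      funext i
      rw [← coe_substHom a ha, substHom_ofPoly]
      simp [a, b, coe_ofPoly]
    rw [this, MvPowerSeries.subst_self]
    rfl
  · rw [substHom_ofPoly]
    simp [a]

end IntegralConvergentSeries

theorem mainTheorem3 {K : Type*} [Field K] (v : AddValuation K (WithTop ℝ))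
    (hv : ∃ a : K, a ≠ 0 ∧ v a ≠ 0) (hK : IsCompleteFor v) (n : ℕ) :
    ringKrullDim (integralConvergentSeries v n) = (n : WithBot ℕ∞) + 1 := by
  refine le_antisymm (IntegralConvergentSeries.ringKrullDim_le hv hK n) ?_
  induction n with
  | zero => simpa using IntegralConvergentSeries.one_le_ringKrullDim hv
  | succ n ih =>
    refine le_trans ?_ (IntegralConvergentSeries.ringKrullDim_succ_le n)
    push_cast
    gcongr
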